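/- Let $p$ be a probability distribution on $\mathbb{R}$ with mean $0$, variance $1$ and finite moments of all orders. For $N \ge 1$ let $b_1,\dots,b_{N-1}$ be independent random variables with law $p$, and let $A$ be the random $N\times N$ real symmetric Toeplitz matrix with entries $a_{ij} = b_{|i-j|}$ for $i \ne j$ and $a_{ii} = 0$. Let $\lambda_1(A),\dots,\lambda_N(A)$ be its eigenvalues, counted with multiplicity, and let $$M_m(A,N) \;=\; \int x^m \, d\mu_{A,N}(x) \;=\; \frac{1}{N^{\frac m2+1}}\sum_{i=1}^N \lambda_i(A)^m, \qquad \mu_{A,N} = \frac1N\sum_{i=1}^N \delta_{\lambda_i(A)/\sqrt N},$$ be the $m$-th moment of the normalized eigenvalue measure of $A$. Then for every integer $m \ge 0$, the random variable $M_m(A,N)$ has finite expectation and finite fourth central moment for all $N \ge 1$, and $$\mathbb{E}\Big[\big|M_m(A,N) - \mathbb{E}[M_m(A,N)]\big|^4\Big] \;=\; O\Big(\frac1{N^2}\Big);$$ that is, there is a constant $C$ depending only on $m$ and $p$ such that the left-hand side is at most $C/N^2$ for all $N\ge1$. -/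

import Mathlib

open MeasureTheory

namespace ToeplitzEnsemble

/-- The `N × N` real symmetric Toeplitz matrix with vanishing main diagonal whose entry at
`(i, j)`, `i ≠ j`, is `b_{|i - j|}`. (The coordinate `b 0` is not used.) -/
def toeplitz (N : ℕ) (b : Fin N → ℝ) : Matrix (Fin N) (Fin N) ℝ :=
  fun i j => if i = j then 0 else b ⟨((i : ℤ) - (j : ℤ)).natAbs, by omega⟩

theorem toeplitz_isHermitian (N : ℕ) (b : Fin N → ℝ) : (toeplitz N b).IsHermitian := by
  ext i j
  have h : ((j : ℤ) - (i : ℤ)).natAbs = ((i : ℤ) - (j : ℤ)).natAbs := by omega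
  simp [toeplitz, Matrix.conjTranspose_apply, eq_comm, h]

/-- The normalized eigenvalue measure of a real symmetric matrix: a point mass `1 / N` at
`λ_i(A) / √N` for each eigenvalue `λ_i(A)`, counted with multiplicity. -/
noncomputable def eigenvalueMeasure {N : ℕ} (A : Matrix (Fin N) (Fin N) ℝ)
    (hA : A.IsHermitian) : Measure ℝ :=
  (N : ENNReal)⁻¹ • ∑ i : Fin N, Measure.dirac (hA.eigenvalues i / √(N : ℝ))

/-- `M_m(A, N)` for the Toeplitz matrix `A` built from `b`: the `m`-th moment of its normalized
eigenvalue measure. -/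
noncomputable def spectralMoment (m N : ℕ) (b : Fin N → ℝ) : ℝ :=
  ∫ x, x ^ m ∂(eigenvalueMeasure (toeplitz N b) (toeplitz_isHermitian N b))

/-- The ensemble: the entries `b_i` are independent with common law `p`. -/
noncomputable def ensemble (p : Measure ℝ) (N : ℕ) : Measure (Fin N → ℝ) :=
  Measure.pi fun _ => p

end ToeplitzEnsemble

/-! The `m`-th spectral moment is a normalized trace of `A ^ m`, a sum over closed walks of length
`m`. The fourth power of the centered trace is therefore a sum over quadruples of closed walks of
centered mixed moments. These are bounded uniformly in `N`, and vanish by independence and mean zero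
unless every diagonal is visited at least twice and every walk shares a diagonal with another
(`integral_prod_sub_circuitMean_eq_zero_of_not_matched`).

It remains to count the matched quadruples. Fix which edges share a diagonal and which steps go up:
finitely many patterns, independently of `N`. The `4 * m` edges carry at most `2 * m` distinct
diagonals; sharing and the closing conditions reduce the free ones to `2 * m - 2`
(`exists_determining_values`). With four starting points this gives `O(N ^ (2 * m + 2))` quadruples,
against the normalization `N ^ (2 * m + 4)`. -/

/-! ### Combinatorics of coincidence patterns -/

theorem Int.odd_sum_iff_odd_card {ι : Type*} (t : Finset ι) (s : ι → ℤ)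
    (hs : ∀ e ∈ t, Odd (s e)) : Odd (∑ e ∈ t, s e) ↔ Odd t.card := by
  classical
  induction t using Finset.induction_on with
  | empty => simp
  | insert a t ha ih =>
    have h1 := hs a (by simp)
    have h2 := ih fun e he => hs e (by simp [he])
    rw [Finset.sum_insert ha, Finset.card_insert_of_notMem ha, Int.odd_add, Nat.odd_add_one,
      ← Int.not_odd_iff_even, h2]
    tauto

/-- For multiplicities with total `4 * m`, each excess of two over the minimum multiplicity two
costs one distinct value. -/
theorem two_mul_card_add_le_sum {V : Type*} {R : Finset V} {f : V → ℕ} (hf : ∀ v ∈ R, 2 ≤ f v) {S : Finset V}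
    (hS : S ⊆ R) : 2 * R.card + ∑ v ∈ S, (f v - 2) ≤ ∑ v ∈ R, f v := by
  have h : ∑ v ∈ R, f v = ∑ v ∈ R, 2 + ∑ v ∈ R, (f v - 2) := by
    rw [← Finset.sum_add_distrib]
    exact Finset.sum_congr rfl fun v hv => by have := hf v hv; omega
  rw [h, Finset.sum_const, smul_eq_mul, mul_comm]
  exact Nat.add_le_add_left (Finset.sum_le_sum_of_subset hS) _

section Patterns

variable {m : ℕ} {V : Type*} [DecidableEq V] (κ : Fin 4 × Fin m → V)

/-- The number of edges of the `j`-th circuit that carry the value `v`. -/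
def patternMult (j : Fin 4) (v : V) : ℕ := (Finset.univ.filter fun l => κ (j, l) = v).card

/-- The coefficient of the value `v` in the closing condition of the `j`-th circuit. -/
def patternCoeff (s : Fin 4 × Fin m → ℤ) (j : Fin 4) (v : V) : ℤ :=
  ∑ l ∈ Finset.univ.filter (fun l => κ (j, l) = v), s (j, l)

theorem patternMult_pos (j : Fin 4) (l : Fin m) : 0 < patternMult κ j (κ (j, l)) :=
  Finset.card_pos.2 ⟨l, by simp⟩

theorem card_fiber_eq_sum_patternMult (v : V) :
    (Finset.univ.filter fun e => κ e = v).card = ∑ j, patternMult κ j v := by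
  simp only [patternMult, Finset.card_filter]
  rw [Fintype.sum_prod_type]

theorem sum_patternMult : ∑ v ∈ Finset.univ.image κ, ∑ j, patternMult κ j v = 4 * m := by
  have h := Finset.card_eq_sum_card_image κ Finset.univ
  simp only [card_fiber_eq_sum_patternMult, Finset.card_univ, Fintype.card_prod,
    Fintype.card_fin] at h
  exact h.symm

theorem sum_mul_eq_sum_patternCoeff (s : Fin 4 × Fin m → ℤ) (z : V → ℤ) (j : Fin 4) :
    ∑ l, s (j, l) * z (κ (j, l)) = ∑ v ∈ Finset.univ.image κ, patternCoeff κ s j v * z v := by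
  rw [← Finset.sum_fiberwise_of_maps_to (s := Finset.univ) (t := Finset.univ.image κ)
    (g := fun l => κ (j, l)) (fun l _ => Finset.mem_image_of_mem _ (Finset.mem_univ _))]
  refine Finset.sum_congr rfl fun v _ => ?_
  rw [patternCoeff, Finset.sum_mul]
  refine Finset.sum_congr rfl fun l hl => ?_
  rw [(Finset.mem_filter.1 hl).2]

/-- If every value occurs at least twice and every circuit shares a value with another one, then
at most `2 m - 2` of the values determine all of them through the closing conditions. -/
theorem exists_determining_values (h₁ : ∀ e, ∃ e', e' ≠ e ∧ κ e' = κ e)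
    (h₂ : ∀ j, ∃ l j' l', j' ≠ j ∧ κ (j', l') = κ (j, l))
    (s : Fin 4 × Fin m → ℤ) (hs : ∀ e, Odd (s e)) :
    ∃ T ⊆ Finset.univ.image κ, T.card + 2 ≤ 2 * m ∧ ∀ z : V → ℤ, (∀ v ∈ T, z v = 0) →
      (∀ j, ∑ l, s (j, l) * z (κ (j, l)) = 0) → ∀ v ∈ Finset.univ.image κ, z v = 0 := by
  set R := Finset.univ.image κ with hR
  have hmem : ∀ e, κ e ∈ R := fun e => Finset.mem_image_of_mem _ (Finset.mem_univ _)
  set f : V → ℕ := fun v => ∑ j, patternMult κ j v with hf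
  have hsum : ∑ v ∈ R, f v = 4 * m := sum_patternMult κ
  have hf2 : ∀ v ∈ R, 2 ≤ f v := by
    intro v hv
    obtain ⟨e, -, rfl⟩ := Finset.mem_image.1 hv
    obtain ⟨e', hne, he'⟩ := h₁ e
    rw [hf]
    simp only
    rw [← card_fiber_eq_sum_patternMult]
    exact Finset.one_lt_card.2 ⟨e', by simp [he'], e, by simp, hne⟩
  -- Odd multiplicity in a circuit forces a nonzero coefficient, so that circuit's closing condition
  -- can be solved for the value.
  have hodd : ∀ j v, Odd (patternCoeff κ s j v) ↔ Odd (patternMult κ j v) := fun j v =>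
    Int.odd_sum_iff_odd_card _ _ fun l _ => hs _
  have hshare : ∀ j, ∃ v ∈ R, 0 < patternMult κ j v ∧ ∃ j', j' ≠ j ∧ 0 < patternMult κ j' v := by
    intro j
    obtain ⟨l, j', l', hj, h⟩ := h₂ j
    exact ⟨_, hmem (j, l), patternMult_pos κ j l, j', hj, h ▸ patternMult_pos κ j' l'⟩
  have hpair : ∀ j j' v, j' ≠ j → patternMult κ j v + patternMult κ j' v ≤ f v := by
    intro j j' v hj
    rw [← Finset.sum_pair (f := fun j => patternMult κ j v) hj.symm]
    exact Finset.sum_le_sum_of_subset (Finset.subset_univ _)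
  have hlin : ∀ z : V → ℤ, (∀ j, ∑ l, s (j, l) * z (κ (j, l)) = 0) →
      ∀ j, ∑ v ∈ R, patternCoeff κ s j v * z v = 0 := fun z hz j =>
    (sum_mul_eq_sum_patternCoeff κ s z j).symm.trans (hz j)
  -- If all multiplicities are even, a shared value has total multiplicity at least 4. Either one
  -- value lies in all four circuits (multiplicity at least 8), or two distinct values are shared;
  -- both give `R.card ≤ 2 * m - 2`.
  by_cases heven : ∀ j, ∀ v ∈ R, Even (patternMult κ j v)
  · refine ⟨R, subset_rfl, ?_, fun z hz _ => hz⟩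
    have hev2 : ∀ j, ∀ v ∈ R, 0 < patternMult κ j v → 2 ≤ patternMult κ j v := by
      intro j v hv h
      obtain ⟨k, hk⟩ := heven j v hv
      omega
    have hbig : ∀ j, ∃ v ∈ R, 0 < patternMult κ j v ∧ 4 ≤ f v := by
      intro j
      obtain ⟨v, hv, h, j', hj, h'⟩ := hshare j
      exact ⟨v, hv, h, by
        linarith [hev2 j v hv h, hev2 j' v hv h', hpair j j' v hj]⟩
    obtain ⟨v, hv, -, hv4⟩ := hbig 0
    by_cases hall : ∀ j, 0 < patternMult κ j v
    · have h8 : 8 ≤ f v := by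
        have := Finset.sum_le_sum fun j (_ : j ∈ Finset.univ) => hev2 j v hv (hall j)
        simpa using this
      have := two_mul_card_add_le_sum hf2 (Finset.singleton_subset_iff.2 hv)
      rw [Finset.sum_singleton] at this
      omega
    · push Not at hall
      obtain ⟨j, hj⟩ := hall
      obtain ⟨w, hw, hjw, hw4⟩ := hbig j
      have hne : v ≠ w := by rintro rfl; omega
      have := two_mul_card_add_le_sum hf2 (S := {v, w})
        (Finset.insert_subset hv (Finset.singleton_subset_iff.2 hw))
      rw [Finset.sum_pair hne] at this
      omega
  · push Not at heven
    obtain ⟨j, x, hx, hjx⟩ := heven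
    rw [Nat.not_even_iff_odd, ← hodd] at hjx
    have hcard := two_mul_card_add_le_sum hf2 (Finset.empty_subset R)
    rw [Finset.sum_empty] at hcard
    -- One value is already saved when `R.card < 2 * m`, and solving for `x` saves the second. In
    -- case of equality all multiplicities are 2, so a shared value occurs once in each of two
    -- circuits.
    rcases Nat.lt_or_ge R.card (2 * m) with hlt | hge
    · refine ⟨R.erase x, Finset.erase_subset _ _, ?_, fun z hz hL => ?_⟩
      · have := Finset.card_erase_add_one hx
        omega
      · have h := hlin z hL j
        rw [Finset.sum_eq_single_of_mem x hx fun v hv hne => by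
          rw [hz v (Finset.mem_erase.2 ⟨hne, hv⟩), mul_zero]] at h
        have h0 : z x = 0 := (mul_eq_zero.1 h).resolve_left fun h0 => by simp [h0] at hjx
        intro v hv
        by_cases hvx : v = x
        · rw [hvx, h0]
        · exact hz v (Finset.mem_erase.2 ⟨hvx, hv⟩)
    · have hf2' : ∀ v ∈ R, f v = 2 := by
        intro v hv
        have := two_mul_card_add_le_sum hf2 (Finset.singleton_subset_iff.2 hv)
        rw [Finset.sum_singleton] at this
        have := hf2 v hv
        omega
      have hone : ∀ j, ∃ v ∈ R, patternMult κ j v = 1 := by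
        intro j
        obtain ⟨v, hv, h, j', hj, h'⟩ := hshare j
        have := hpair j j' v hj
        rw [hf2' v hv] at this
        exact ⟨v, hv, by omega⟩
      have hcne : ∀ j v, patternMult κ j v = 1 → patternCoeff κ s j v ≠ 0 := by
        intro j v h h0
        have := (hodd j v).2 (by rw [h]; exact odd_one)
        simp [h0] at this
      obtain ⟨v, hv, h0v⟩ := hone 0
      -- A circuit avoiding `v` makes the system triangular: circuit `j` determines `w` without `v`,
      -- then circuit 0 determines `v`.
      obtain ⟨j, hj⟩ : ∃ j, patternMult κ j v = 0 := by
        by_contra! hall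
        have : ∑ _j : Fin 4, 1 ≤ f v :=
          Finset.sum_le_sum fun j (_ : j ∈ Finset.univ) => Nat.one_le_iff_ne_zero.2 (hall j)
        rw [hf2' v hv] at this
        simp at this
      have hjc : patternCoeff κ s j v = 0 := by
        rw [patternMult, Finset.card_eq_zero] at hj
        rw [patternCoeff, hj, Finset.sum_empty]
      obtain ⟨w, hw, hjw⟩ := hone j
      have hwv : w ≠ v := by rintro rfl; omega
      refine ⟨(R.erase v).erase w, (Finset.erase_subset _ _).trans (Finset.erase_subset _ _), ?_,
        fun z hz hL => ?_⟩
      · have h1 := Finset.card_erase_add_one hv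
        have h2 := Finset.card_erase_add_one (Finset.mem_erase.2 ⟨hwv, hw⟩)
        omega
      · have hz' : ∀ u ∈ R, u ≠ v → u ≠ w → z u = 0 := fun u hu h1 h2 =>
          hz u (Finset.mem_erase.2 ⟨h2, Finset.mem_erase.2 ⟨h1, hu⟩⟩)
        have hzw : z w = 0 := by
          have h := hlin z hL j
          rw [Finset.sum_eq_single_of_mem w hw fun u hu hne => by
            by_cases huv : u = v
            · rw [huv, hjc, zero_mul]
            · rw [hz' u hu huv hne, mul_zero]] at h
          exact (mul_eq_zero.1 h).resolve_left (hcne _ _ hjw)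
        have hzv : z v = 0 := by
          have h := hlin z hL 0
          rw [Finset.sum_eq_single_of_mem v hv fun u hu hne => by
            by_cases huw : u = w
            · rw [huw, hzw, mul_zero]
            · rw [hz' u hu hne huw, mul_zero]] at h
          exact (mul_eq_zero.1 h).resolve_left (hcne _ _ h0v)
        intro u hu
        by_cases huv : u = v
        · rw [huv, hzv]
        by_cases huw : u = w
        · rw [huw, hzw]
        exact hz' u hu huv huw

end Patterns

/-! ### Counting matched quadruples of walks -/

theorem Fin.sum_succ_sub_castSucc {m : ℕ} (f : Fin (m + 1) → ℤ) :
    ∑ l : Fin m, (f l.succ - f l.castSucc) = f (Fin.last m) - f 0 := by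
  have h := (Fin.sum_univ_succ f).symm.trans (Fin.sum_univ_castSucc f)
  rw [Finset.sum_sub_distrib]
  linarith

section Walks

variable {m N : ℕ}

/-- The absolute value of the `l`-th step of a walk, as the index of a Toeplitz diagonal. -/
def stepSize (i : Fin (m + 1) → Fin N) (l : Fin m) : Fin N :=
  ⟨((i l.castSucc : ℤ) - (i l.succ : ℤ)).natAbs, by omega⟩

/-- Whether the `l`-th step of a walk is upwards. -/
def stepUp (i : Fin (m + 1) → Fin N) (l : Fin m) : Bool :=
  decide (i l.castSucc ≤ i l.succ)

theorem step_eq (i : Fin (m + 1) → Fin N) (l : Fin m) :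
    (if stepUp i l then 1 else -1) * (stepSize i l : ℤ) = (i l.succ : ℤ) - (i l.castSucc : ℤ) := by
  by_cases h : i l.castSucc ≤ i l.succ
  · have h' := Fin.le_def.1 h
    simp only [stepUp, stepSize, h, decide_true, if_true]
    omega
  · have h' := fun h' => h (Fin.le_def.2 h')
    simp only [stepUp, stepSize, h, decide_false, Bool.false_eq_true, if_false]
    omega

theorem walk_ext {i i' : Fin (m + 1) → Fin N} (h0 : i 0 = i' 0)
    (hd : ∀ l, stepSize i l = stepSize i' l) (hs : ∀ l, stepUp i l = stepUp i' l) : i = i' := by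
  funext k
  induction k using Fin.induction with
  | zero => exact h0
  | succ l ih =>
    have h1 := step_eq i l
    have h2 := step_eq i' l
    rw [hd, hs, h2, ih] at h1
    exact Fin.ext (by omega)

/-- The index of the diagonal visited by an edge of a quadruple of walks. -/
def edgeValue (i : Fin 4 → Fin (m + 1) → Fin N) (e : Fin 4 × Fin m) : Fin N :=
  stepSize (i e.1) e.2

/-- A quadruple of closed walks in which every diagonal that occurs does so at least twice and
every walk shares a diagonal with another one. -/
structure IsMatchedQuadruple (i : Fin 4 → Fin (m + 1) → Fin N) : Prop where
  closed : ∀ j, i j 0 = i j (Fin.last m)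
  repeated : ∀ e, ∃ e', e' ≠ e ∧ edgeValue i e' = edgeValue i e
  shared : ∀ j, ∃ l j' l', j' ≠ j ∧ edgeValue i (j', l') = edgeValue i (j, l)

/-- The coincidences between the diagonals and the directions of the steps of a quadruple. -/
def quadruplePattern (i : Fin 4 → Fin (m + 1) → Fin N) :
    ((Fin 4 × Fin m) × (Fin 4 × Fin m) → Bool) × (Fin 4 × Fin m → Bool) :=
  (fun q => decide (edgeValue i q.1 = edgeValue i q.2), fun e => stepUp (i e.1) e.2)

-- Within one pattern, the four starting points and the values in `T` determine the quadruple; this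
-- injects it into a set of size at most `N ^ (4 + (2 * m - 2))`.
open Classical in
theorem card_matchedQuadruple_pattern_le (hN : 1 ≤ N) {i₀ : Fin 4 → Fin (m + 1) → Fin N}
    (h₀ : IsMatchedQuadruple i₀) :
    (Finset.univ.filter fun i : Fin 4 → Fin (m + 1) → Fin N => IsMatchedQuadruple i ∧
      quadruplePattern i = quadruplePattern i₀).card ≤ N ^ (2 * m + 2) := by
  obtain ⟨T, hTR, hT, hdet⟩ := exists_determining_values (edgeValue i₀) h₀.repeated h₀.shared
    (fun e => if stepUp (i₀ e.1) e.2 then 1 else -1) (fun e => by split_ifs <;> decide)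
  obtain ⟨l₀, -⟩ := h₀.shared 0
  have : Nonempty (Fin 4 × Fin m) := ⟨(0, l₀)⟩
  have hex : ∀ v, ∃ e, v ∈ Finset.univ.image (edgeValue i₀) → edgeValue i₀ e = v := by
    intro v
    by_cases hv : v ∈ Finset.univ.image (edgeValue i₀)
    · obtain ⟨e, -, he⟩ := Finset.mem_image.1 hv
      exact ⟨e, fun _ => he⟩
    · exact ⟨(0, l₀), fun h => absurd h hv⟩
  choose σ hσ using hex
  have hcard : Fintype.card ((Fin 4 → Fin N) × (T → Fin N)) ≤ N ^ (2 * m + 2) := by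
    simp only [Fintype.card_prod, Fintype.card_fun, Fintype.card_fin, Fintype.card_coe]
    rw [← pow_add]
    exact Nat.pow_le_pow_right hN (by omega)
  refine le_trans ?_ hcard
  rw [← Finset.card_univ]
  refine Finset.card_le_card_of_injOn
    (fun i => (fun j => i j 0, fun v => edgeValue i (σ v))) (fun _ _ => Finset.mem_univ _) ?_
  intro i hi i' hi' hii
  obtain ⟨hi, hpi⟩ := (Finset.mem_filter.1 hi).2
  obtain ⟨hi', hpi'⟩ := (Finset.mem_filter.1 hi').2
  obtain ⟨hstart, hval⟩ := Prod.mk.inj hii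
  have hup : ∀ i : Fin 4 → Fin (m + 1) → Fin N, quadruplePattern i = quadruplePattern i₀ →
      ∀ e : Fin 4 × Fin m, stepUp (i e.1) e.2 = stepUp (i₀ e.1) e.2 := fun i h e =>
    congrFun (congrArg Prod.snd h) e
  have hrep : ∀ i : Fin 4 → Fin (m + 1) → Fin N, quadruplePattern i = quadruplePattern i₀ →
      ∀ e, edgeValue i (σ (edgeValue i₀ e)) = edgeValue i e := by
    intro i h e
    have h1 := congrFun (congrArg Prod.fst h) (σ (edgeValue i₀ e), e)
    have h2 := hσ _ (Finset.mem_image_of_mem (edgeValue i₀) (Finset.mem_univ e))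
    simpa [quadruplePattern, h2] using h1
  have hclosed : ∀ i : Fin 4 → Fin (m + 1) → Fin N, IsMatchedQuadruple i →
      quadruplePattern i = quadruplePattern i₀ → ∀ j,
      ∑ l, (if stepUp (i₀ j) l then 1 else -1) * (edgeValue i (j, l) : ℤ) = 0 := by
    intro i h hp j
    have : ∀ l, (if stepUp (i₀ j) l then 1 else -1) * (edgeValue i (j, l) : ℤ) =
        ((i j l.succ : ℕ) : ℤ) - ((i j l.castSucc : ℕ) : ℤ) := by
      intro l
      rw [← hup i hp (j, l)]
      exact step_eq (i j) l
    simp only [this]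
    rw [Fin.sum_succ_sub_castSucc (fun k => ((i j k : ℕ) : ℤ)), h.closed j, sub_self]
  -- The closing conditions have the same signs for both quadruples, so the difference of their
  -- diagonals solves the homogeneous system.
  have hz := hdet (fun v => (edgeValue i (σ v) : ℤ) - (edgeValue i' (σ v) : ℤ))
    (fun v hv => by
      have := congrFun hval ⟨v, hv⟩
      simp only at this
      rw [this, sub_self])
    (fun j => by
      simp only [hrep i hpi, hrep i' hpi', mul_sub, Finset.sum_sub_distrib]
      rw [hclosed i hi hpi, hclosed i' hi' hpi', sub_self])
  funext j
  refine walk_ext (congrFun hstart j) (fun l => ?_) (fun l => ?_)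
  · have := hz _ (Finset.mem_image_of_mem (edgeValue i₀) (Finset.mem_univ (j, l)))
    simp only [hrep i hpi, hrep i' hpi'] at this
    exact Fin.ext (by simp only [edgeValue] at this; omega)
  · exact (hup i hpi (j, l)).trans (hup i' hpi' (j, l)).symm

open Classical in
theorem card_matchedQuadruple_le (m : ℕ) : ∃ K : ℕ, ∀ N, 1 ≤ N →
    (Finset.univ.filter fun i : Fin 4 → Fin (m + 1) → Fin N => IsMatchedQuadruple i).card ≤
      K * N ^ (2 * m + 2) := by
  refine ⟨Fintype.card
    (((Fin 4 × Fin m) × (Fin 4 × Fin m) → Bool) × (Fin 4 × Fin m → Bool)), fun N hN => ?_⟩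
  rw [mul_comm]
  refine (Finset.card_le_mul_card_image (f := quadruplePattern) _ (N ^ (2 * m + 2)) ?_).trans
    (Nat.mul_le_mul_left _ (Finset.card_le_univ _))
  intro c hc
  obtain ⟨i₀, hi₀, rfl⟩ := Finset.mem_image.1 hc
  rw [Finset.filter_filter]
  exact card_matchedQuadruple_pattern_le hN (Finset.mem_filter.1 hi₀).2

end Walks

/-! ### Traces of powers as sums over closed walks -/

/-- The arbitrary weight `f` lets the induction absorb the last factor of `A`; the trace is the case
of the diagonal indicator. -/
theorem Matrix.sum_mul_pow_apply {n R : Type*} [Fintype n] [DecidableEq n] [CommSemiring R]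
    (A : Matrix n n R) (m : ℕ) (f : n → n → R) :
    ∑ a, ∑ b, f a b * (A ^ m) a b =
      ∑ i : Fin (m + 1) → n, f (i 0) (i (Fin.last m)) * ∏ l : Fin m, A (i l.castSucc) (i l.succ) := by
  induction m generalizing f with
  | zero =>
    rw [← (Equiv.funUnique (Fin 1) n).symm.sum_comp]
    simp [Matrix.one_apply]
  | succ m ih =>
    rw [← (Fin.snocEquiv fun _ : Fin (m + 2) => n).sum_comp, Fintype.sum_prod_type_right]
    have h : ∀ a b, f a b * (A ^ (m + 1)) a b = ∑ c, f a b * A c b * (A ^ m) a c := by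
      intro a b
      rw [pow_succ, Matrix.mul_apply, Finset.mul_sum]
      exact Finset.sum_congr rfl fun c _ => by ring
    have h' : ∀ a, ∑ b, f a b * (A ^ (m + 1)) a b =
        ∑ c, (∑ b, f a b * A c b) * (A ^ m) a c := by
      intro a
      simp only [h, Finset.sum_mul]
      exact Finset.sum_comm
    simp only [h', ih fun a c => ∑ b, f a b * A c b]
    refine Finset.sum_congr rfl fun i _ => ?_
    rw [Finset.sum_mul]
    refine Finset.sum_congr rfl fun b _ => ?_
    rw [Fin.prod_univ_castSucc]
    have h0 : (Fin.snocEquiv fun _ : Fin (m + 2) => n) (b, i) 0 = i 0 :=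
      Fin.snoc_castSucc (α := fun _ => n) b i 0
    simp only [h0]
    simp only [Fin.snocEquiv_apply, Fin.snoc_last, Fin.snoc_castSucc, Fin.succ_castSucc, Fin.succ_last]
    ring

theorem Matrix.trace_pow_eq_sum_closed_walks {n R : Type*} [Fintype n] [DecidableEq n]
    [CommSemiring R] (A : Matrix n n R) (m : ℕ) :
    (A ^ m).trace = ∑ i ∈ Finset.univ.filter (fun i : Fin (m + 1) → n => i 0 = i (Fin.last m)),
      ∏ l : Fin m, A (i l.castSucc) (i l.succ) := by
  have h := Matrix.sum_mul_pow_apply A m fun a b => if a = b then 1 else 0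
  simp only [ite_mul, one_mul, zero_mul, Finset.sum_ite_eq, Finset.mem_univ, if_true] at h
  rw [Finset.sum_filter, ← h]
  rfl

theorem Matrix.IsHermitian.trace_pow_eq_sum_eigenvalues_pow {n : Type*} [Fintype n] [DecidableEq n]
    {A : Matrix n n ℝ} (hA : A.IsHermitian) (m : ℕ) :
    (A ^ m).trace = ∑ i, hA.eigenvalues i ^ m := by
  conv_lhs => rw [hA.spectral_theorem, ← map_pow, Unitary.conjStarAlgAut_apply,
    Matrix.trace_mul_comm, ← mul_assoc]
  simp [Matrix.diagonal_pow, Matrix.trace_diagonal]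

/-! ### Mixed moments of the Toeplitz entries -/

namespace ToeplitzEnsemble

theorem spectralMoment_eq_trace (m N : ℕ) (b : Fin N → ℝ) :
    spectralMoment m N b = ((N : ℝ) * √(N : ℝ) ^ m)⁻¹ * (toeplitz N b ^ m).trace := by
  rw [spectralMoment, eigenvalueMeasure, integral_smul_measure, integral_finsetSum_measure
    fun i _ => integrable_dirac (by simp)]
  rw [(toeplitz_isHermitian N b).trace_pow_eq_sum_eigenvalues_pow m]
  simp only [integral_dirac, ENNReal.toReal_inv, ENNReal.toReal_natCast, smul_eq_mul, mul_inv,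
    div_eq_mul_inv, mul_pow, inv_pow]
  rw [← Finset.sum_mul]
  ring

/-- The contribution of the variable `x` to the `k`-th diagonal: the main diagonal vanishes. -/
noncomputable def diagonalEntry {N : ℕ} (k : Fin N) (x : ℝ) : ℝ := if (k : ℕ) = 0 then 0 else x

theorem toeplitz_apply_eq_diagonalEntry {m N : ℕ} (b : Fin N → ℝ) (i : Fin (m + 1) → Fin N)
    (l : Fin m) : toeplitz N b (i l.castSucc) (i l.succ) =
      diagonalEntry (stepSize i l) (b (stepSize i l)) := by
  have h : ((stepSize i l : Fin N) : ℕ) = 0 ↔ i l.castSucc = i l.succ := by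
    simp only [stepSize, Fin.ext_iff]
    omega
  simp only [toeplitz, diagonalEntry, h]
  rfl

/-- The product over the edges in `S` of the entries on the diagonals prescribed by `D`. -/
noncomputable def edgeProduct {N : ℕ} {ι : Type*} (D : ι → Fin N) (S : Finset ι) (b : Fin N → ℝ) :
    ℝ := ∏ e ∈ S, diagonalEntry (D e) (b (D e))

theorem trace_toeplitz_pow (m N : ℕ) (b : Fin N → ℝ) : (toeplitz N b ^ m).trace =
    ∑ i ∈ Finset.univ.filter (fun i : Fin (m + 1) → Fin N => i 0 = i (Fin.last m)),
      edgeProduct (stepSize i) Finset.univ b := by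
  rw [Matrix.trace_pow_eq_sum_closed_walks]
  exact Finset.sum_congr rfl fun i _ => Finset.prod_congr rfl fun l _ =>
    toeplitz_apply_eq_diagonalEntry b i l

section Moments

variable {p : Measure ℝ} [IsProbabilityMeasure p] {N : ℕ} {ι : Type*} (D : ι → Fin N)

theorem edgeProduct_eq_prod_pow (S : Finset ι) (b : Fin N → ℝ) : edgeProduct D S b =
    ∏ k, diagonalEntry k (b k) ^ (S.filter fun e => D e = k).card := by
  rw [edgeProduct, ← Finset.prod_fiberwise' S D fun k => diagonalEntry k (b k)]
  simp

theorem integrable_diagonalEntry_pow (hp : ∀ k : ℕ, Integrable (fun x : ℝ => x ^ k) p) (k : Fin N)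
    (n : ℕ) : Integrable (fun x => diagonalEntry k x ^ n) p := by
  by_cases hk : (k : ℕ) = 0
  · simp [diagonalEntry, hk]
  · simpa [diagonalEntry, hk] using hp n

theorem integrable_edgeProduct (hp : ∀ k : ℕ, Integrable (fun x : ℝ => x ^ k) p) (S : Finset ι) :
    Integrable (edgeProduct D S) (ensemble p N) := by
  rw [funext (edgeProduct_eq_prod_pow D S)]
  exact Integrable.fintype_prod fun k => integrable_diagonalEntry_pow hp k _

variable (p) in
theorem integral_edgeProduct (S : Finset ι) : ∫ b, edgeProduct D S b ∂(ensemble p N) =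
    ∏ k, ∫ x, diagonalEntry k x ^ (S.filter fun e => D e = k).card ∂p := by
  simp only [edgeProduct_eq_prod_pow]
  exact integral_fintype_prod_eq_prod
    (fun k x => diagonalEntry k x ^ (S.filter fun e => D e = k).card)

variable (p) in
theorem integral_edgeProduct_union [DecidableEq ι] {S S' : Finset ι}
    (h : ∀ e ∈ S, ∀ e' ∈ S', D e ≠ D e') :
    ∫ b, edgeProduct D (S ∪ S') b ∂(ensemble p N) =
      (∫ b, edgeProduct D S b ∂(ensemble p N)) * ∫ b, edgeProduct D S' b ∂(ensemble p N) := by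
  simp only [integral_edgeProduct]
  rw [← Finset.prod_mul_distrib]
  refine Finset.prod_congr rfl fun k _ => ?_
  rw [Finset.filter_union]
  rcases (S.filter fun e => D e = k).eq_empty_or_nonempty with h0 | ⟨e, he⟩
  · simp [h0]
  · have h0 : (S'.filter fun e => D e = k) = ∅ := by
      refine Finset.filter_eq_empty_iff.2 fun e' he' hk => ?_
      obtain ⟨he, hek⟩ := Finset.mem_filter.1 he
      exact h e he e' he' (hek.trans hk.symm)
    simp [h0]

theorem integral_edgeProduct_eq_zero (hmean : ∫ x, x ∂p = 0) {S : Finset ι} {e : ι} (he : e ∈ S)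
    (h : ∀ e' ∈ S, e' ≠ e → D e' ≠ D e) : ∫ b, edgeProduct D S b ∂(ensemble p N) = 0 := by
  rw [integral_edgeProduct]
  refine Finset.prod_eq_zero (Finset.mem_univ (D e)) ?_
  have h1 : (S.filter fun e' => D e' = D e) = {e} := by
    ext e'
    simp only [Finset.mem_filter, Finset.mem_singleton]
    refine ⟨fun h' => by_contra fun hne => h e' h'.1 hne h'.2, ?_⟩
    rintro rfl
    exact ⟨he, rfl⟩
  by_cases hk : (D e : ℕ) = 0 <;> simp [h1, diagonalEntry, hk, hmean]

variable (p) in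
/-- All moments of products of at most `L` entries are bounded uniformly in the size. -/
theorem exists_abs_integral_edgeProduct_le (L : ℕ) : ∃ B : ℝ, 1 ≤ B ∧ ∀ {N : ℕ} {ι : Type}
    (D : ι → Fin N) (S : Finset ι), S.card ≤ L →
      |∫ b, edgeProduct D S b ∂(ensemble p N)| ≤ B := by
  set M : ℝ := 1 + ∑ r ∈ Finset.range (L + 1), |∫ x, x ^ r ∂p| with hM
  have hM1 : 1 ≤ M := le_add_of_nonneg_right (Finset.sum_nonneg fun _ _ => abs_nonneg _)
  refine ⟨M ^ L, one_le_pow₀ hM1, fun {N ι} D S hS => ?_⟩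
  -- The exponent `r` on the right matters: unvisited diagonals contribute a factor 1, so the
  -- product over all `N` diagonals is at most `M ^ S.card`.
  have hentry : ∀ (k : Fin N) (r : ℕ), r ≤ L → |∫ x, diagonalEntry k x ^ r ∂p| ≤ M ^ r := by
    intro k r hr
    rcases Nat.eq_zero_or_pos r with rfl | hr0
    · simp
    · refine le_trans ?_ (le_self_pow₀ hM1 hr0.ne')
      by_cases hk : (k : ℕ) = 0
      · simp only [diagonalEntry, hk, if_true, zero_pow hr0.ne', integral_zero, abs_zero]
        linarith
      · simp only [diagonalEntry, hk, if_false]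
        have := Finset.single_le_sum (f := fun r => |∫ x, x ^ r ∂p|) (fun _ _ => abs_nonneg _)
          (Finset.mem_range.2 (Nat.lt_succ_of_le hr))
        linarith
  rw [integral_edgeProduct, Finset.abs_prod]
  calc ∏ k, |∫ x, diagonalEntry k x ^ (S.filter fun e => D e = k).card ∂p|
      ≤ ∏ k, M ^ (S.filter fun e => D e = k).card :=
        Finset.prod_le_prod (fun _ _ => abs_nonneg _) fun k _ =>
          hentry k _ ((Finset.card_filter_le _ _).trans hS)
    _ = M ^ S.card := by
        rw [Finset.prod_pow_eq_pow_sum]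
        congr 1
        exact (Finset.card_eq_sum_card_fiberwise fun _ _ => Finset.mem_univ _).symm
    _ ≤ M ^ L := pow_le_pow_right₀ hM1 hS

end Moments

end ToeplitzEnsemble

/-! ### Centered mixed moments of four circuits -/

namespace ToeplitzEnsemble

section Centered

variable {p : Measure ℝ} [IsProbabilityMeasure p] {N m : ℕ} (D : Fin 4 × Fin m → Fin N)

/-- The edges of the circuits in `t`. -/
def circuitEdges (m : ℕ) (t : Finset (Fin 4)) : Finset (Fin 4 × Fin m) := t ×ˢ Finset.univ

theorem mem_circuitEdges {t : Finset (Fin 4)} {e : Fin 4 × Fin m} :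
    e ∈ circuitEdges m t ↔ e.1 ∈ t := by
  simp [circuitEdges]

theorem card_circuitEdges_le (t : Finset (Fin 4)) : (circuitEdges m t).card ≤ 4 * m := by
  simpa using Finset.card_le_univ (circuitEdges m t)

theorem edgeProduct_circuitEdges (t : Finset (Fin 4)) (b : Fin N → ℝ) :
    edgeProduct D (circuitEdges m t) b = ∏ j ∈ t, edgeProduct D (circuitEdges m {j}) b := by
  simp only [edgeProduct, circuitEdges, Finset.prod_product, Finset.prod_singleton]

variable (p) in
/-- The expected contribution of the `j`-th circuit. -/
noncomputable def circuitMean (j : Fin 4) : ℝ :=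
  ∫ b, edgeProduct D (circuitEdges m {j}) b ∂(ensemble p N)

theorem prod_sub_circuitMean {p : Measure ℝ} (s : Finset (Fin 4)) (b : Fin N → ℝ) :
    ∏ j ∈ s, (edgeProduct D (circuitEdges m {j}) b - circuitMean p D j) =
      ∑ t ∈ s.powerset, ((-1) ^ t.card * ∏ j ∈ t, circuitMean p D j) *
        edgeProduct D (circuitEdges m (s \ t)) b := by
  rw [Finset.prod_sub]
  refine Finset.sum_congr rfl fun t _ => ?_
  rw [edgeProduct_circuitEdges D (s \ t)]
  ring

theorem integrable_prod_sub_circuitMean (hp : ∀ k : ℕ, Integrable (fun x : ℝ => x ^ k) p)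
    (s : Finset (Fin 4)) : Integrable (fun b =>
      ∏ j ∈ s, (edgeProduct D (circuitEdges m {j}) b - circuitMean p D j)) (ensemble p N) := by
  simp only [prod_sub_circuitMean]
  exact integrable_finsetSum _ fun t _ => (integrable_edgeProduct D hp _).const_mul _

theorem integral_prod_sub_circuitMean (hp : ∀ k : ℕ, Integrable (fun x : ℝ => x ^ k) p)
    (s : Finset (Fin 4)) :
    ∫ b, ∏ j ∈ s, (edgeProduct D (circuitEdges m {j}) b - circuitMean p D j) ∂(ensemble p N) =
      ∑ t ∈ s.powerset, ((-1) ^ t.card * ∏ j ∈ t, circuitMean p D j) *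
        ∫ b, edgeProduct D (circuitEdges m (s \ t)) b ∂(ensemble p N) := by
  simp only [prod_sub_circuitMean]
  rw [integral_finsetSum _ fun t _ => (integrable_edgeProduct D hp _).const_mul _]
  simp only [integral_const_mul]

variable (p) in
theorem exists_abs_integral_prod_sub_circuitMean_le
    (hp : ∀ k : ℕ, Integrable (fun x : ℝ => x ^ k) p) (m : ℕ) :
    ∃ B : ℝ, 0 ≤ B ∧ ∀ {N : ℕ} (D : Fin 4 × Fin m → Fin N),
      ∫ b, ∏ j, (edgeProduct D (circuitEdges m {j}) b - circuitMean p D j) ∂(ensemble p N) ≤ B := by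
  obtain ⟨B, hB1, hB⟩ := exists_abs_integral_edgeProduct_le p (4 * m)
  have hB0 : 0 ≤ B := zero_le_one.trans hB1
  refine ⟨∑ t ∈ (Finset.univ : Finset (Fin 4)).powerset, B ^ t.card * B,
    Finset.sum_nonneg fun _ _ => by positivity, fun {N} D => ?_⟩
  rw [integral_prod_sub_circuitMean D hp]
  refine Finset.sum_le_sum fun t _ => (le_abs_self _).trans ?_
  rw [abs_mul, abs_mul, abs_pow, abs_neg, abs_one, one_pow, one_mul, Finset.abs_prod]
  refine mul_le_mul ?_ (hB D _ (card_circuitEdges_le _)) (abs_nonneg _) (by positivity)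
  rw [← Finset.prod_const]
  exact Finset.prod_le_prod (fun _ _ => abs_nonneg _) fun j _ => hB D _ (card_circuitEdges_le _)

/-- If the `j`-th circuit factors out of all mixed moments, the centered mixed moment vanishes. -/
theorem integral_prod_sub_circuitMean_eq_zero (hp : ∀ k : ℕ, Integrable (fun x : ℝ => x ^ k) p)
    (j : Fin 4) (h : ∀ t : Finset (Fin 4), j ∉ t →
      ∫ b, edgeProduct D (circuitEdges m (insert j t)) b ∂(ensemble p N) =
        circuitMean p D j * ∫ b, edgeProduct D (circuitEdges m t) b ∂(ensemble p N)) :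
    ∫ b, ∏ j, (edgeProduct D (circuitEdges m {j}) b - circuitMean p D j) ∂(ensemble p N) = 0 := by
  have hj : j ∉ Finset.univ.erase j := Finset.notMem_erase _ _
  rw [integral_prod_sub_circuitMean D hp, ← Finset.insert_erase (Finset.mem_univ j),
    Finset.sum_powerset_insert hj, ← Finset.sum_add_distrib]
  -- The terms of `t` and `insert j t` cancel: they have opposite signs, and by `h` the same
  -- absolute value.
  refine Finset.sum_eq_zero fun t ht => ?_
  have hjt : j ∉ t := fun h' => hj (Finset.mem_powerset.1 ht h')
  have h1 : insert j (Finset.univ.erase j) \ t = insert j (Finset.univ.erase j \ t) :=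
    Finset.insert_sdiff_of_notMem _ hjt
  have h2 : insert j (Finset.univ.erase j) \ insert j t = Finset.univ.erase j \ t := by
    ext k
    simp only [Finset.mem_sdiff, Finset.mem_insert, Finset.mem_erase]
    tauto
  rw [h1, h2, h _ (by simp), Finset.card_insert_of_notMem hjt, Finset.prod_insert hjt]
  ring

theorem circuitEdges_insert (j : Fin 4) (t : Finset (Fin 4)) :
    circuitEdges m (insert j t) = circuitEdges m {j} ∪ circuitEdges m t := by
  ext e
  simp [mem_circuitEdges]

/-- The centered mixed moment of four closed walks vanishes unless they are matched. -/
theorem integral_prod_sub_circuitMean_eq_zero_of_not_matched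
    (hp : ∀ k : ℕ, Integrable (fun x : ℝ => x ^ k) p) (hmean : ∫ x, x ∂p = 0)
    {i : Fin 4 → Fin (m + 1) → Fin N} (hi : ∀ j, i j 0 = i j (Fin.last m))
    (hni : ¬ IsMatchedQuadruple i) :
    ∫ b, ∏ j, (edgeProduct (edgeValue i) (circuitEdges m {j}) b - circuitMean p (edgeValue i) j)
      ∂(ensemble p N) = 0 := by
  -- Either some circuit shares no diagonal and factors out by independence, or some diagonal occurs
  -- only once and mean zero makes both sides of the factorization vanish.
  by_cases hrep : ∀ e, ∃ e', e' ≠ e ∧ edgeValue i e' = edgeValue i e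
  · have hsh : ¬ ∀ j, ∃ l j' l', j' ≠ j ∧ edgeValue i (j', l') = edgeValue i (j, l) :=
      fun h => hni ⟨hi, hrep, h⟩
    push Not at hsh
    obtain ⟨j, hj⟩ := hsh
    refine integral_prod_sub_circuitMean_eq_zero _ hp j fun t hjt => ?_
    rw [circuitEdges_insert, integral_edgeProduct_union p, circuitMean]
    rintro ⟨k, l⟩ he ⟨k', l'⟩ he' heq
    have hk : k = j := by simpa using mem_circuitEdges.1 he
    have hk' : k' ∈ t := mem_circuitEdges.1 he'
    subst hk
    exact hj l k' l' (fun h => hjt (h ▸ hk')) heq.symm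
  · push Not at hrep
    obtain ⟨e, he⟩ := hrep
    refine integral_prod_sub_circuitMean_eq_zero _ hp e.1 fun t _ => ?_
    rw [circuitMean, integral_edgeProduct_eq_zero (edgeValue i) hmean (e := e)
        (mem_circuitEdges.2 (by simp)) fun e' _ h => he e' h,
      integral_edgeProduct_eq_zero (edgeValue i) hmean (e := e)
        (mem_circuitEdges.2 (by simp)) fun e' _ h => he e' h, zero_mul]

end Centered

/-! ### The fourth central moment -/

section FourthMoment

variable {p : Measure ℝ} [IsProbabilityMeasure p]

theorem edgeProduct_edgeValue {m N : ℕ} (i : Fin 4 → Fin (m + 1) → Fin N) (j : Fin 4)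
    (b : Fin N → ℝ) : edgeProduct (edgeValue i) (circuitEdges m {j}) b =
      edgeProduct (stepSize (i j)) Finset.univ b := by
  simp only [edgeProduct, circuitEdges, Finset.prod_product, Finset.prod_singleton]
  rfl

theorem integrable_trace_toeplitz_pow (hp : ∀ k : ℕ, Integrable (fun x : ℝ => x ^ k) p)
    (m N : ℕ) : Integrable (fun b => (toeplitz N b ^ m).trace) (ensemble p N) := by
  simp only [trace_toeplitz_pow]
  exact integrable_finsetSum _ fun i _ => integrable_edgeProduct _ hp _

theorem trace_sub_integral_pow_four (hp : ∀ k : ℕ, Integrable (fun x : ℝ => x ^ k) p)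
    (m N : ℕ) (b : Fin N → ℝ) :
    ((toeplitz N b ^ m).trace - ∫ b', (toeplitz N b' ^ m).trace ∂(ensemble p N)) ^ 4 =
      ∑ i ∈ Fintype.piFinset fun _ : Fin 4 =>
          Finset.univ.filter (fun i : Fin (m + 1) → Fin N => i 0 = i (Fin.last m)),
        ∏ j, (edgeProduct (edgeValue i) (circuitEdges m {j}) b -
          circuitMean p (edgeValue i) j) := by
  simp only [trace_toeplitz_pow]
  rw [integral_finsetSum _ fun i _ => integrable_edgeProduct _ hp _, ← Finset.sum_sub_distrib,
    Finset.sum_pow']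
  simp only [circuitMean, edgeProduct_edgeValue]

theorem integrable_trace_sub_integral_pow_four (hp : ∀ k : ℕ, Integrable (fun x : ℝ => x ^ k) p)
    (m N : ℕ) : Integrable (fun b => ((toeplitz N b ^ m).trace -
      ∫ b', (toeplitz N b' ^ m).trace ∂(ensemble p N)) ^ 4) (ensemble p N) := by
  simp only [trace_sub_integral_pow_four hp]
  exact integrable_finsetSum _ fun i _ => integrable_prod_sub_circuitMean _ hp _

theorem exists_integral_trace_sub_integral_pow_four_le
    (hp : ∀ k : ℕ, Integrable (fun x : ℝ => x ^ k) p) (hmean : ∫ x, x ∂p = 0) (m : ℕ) :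
    ∃ C : ℝ, ∀ N : ℕ, 1 ≤ N → ∫ b, ((toeplitz N b ^ m).trace -
      ∫ b', (toeplitz N b' ^ m).trace ∂(ensemble p N)) ^ 4 ∂(ensemble p N) ≤
        C * (N : ℝ) ^ (2 * m + 2) := by
  classical
  obtain ⟨K, hK⟩ := card_matchedQuadruple_le m
  obtain ⟨B, hB0, hB⟩ := exists_abs_integral_prod_sub_circuitMean_le p hp m
  refine ⟨K * B, fun N hN => ?_⟩
  simp only [trace_sub_integral_pow_four hp]
  rw [integral_finsetSum _ fun i _ => integrable_prod_sub_circuitMean _ hp _]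
  set Q := Fintype.piFinset fun _ : Fin 4 =>
    Finset.univ.filter (fun i : Fin (m + 1) → Fin N => i 0 = i (Fin.last m)) with hQ
  have hclosed : ∀ i ∈ Q, ∀ j, i j 0 = i j (Fin.last m) := fun i hi j =>
    (Finset.mem_filter.1 (Fintype.mem_piFinset.1 hi j)).2
  calc _ ≤ ∑ i ∈ Q, if IsMatchedQuadruple i then B else 0 := by
        refine Finset.sum_le_sum fun i hi => ?_
        split_ifs with h
        · exact hB _
        · exact (integral_prod_sub_circuitMean_eq_zero_of_not_matched hp hmean
            (hclosed i hi) h).le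
    _ ≤ ∑ i, if IsMatchedQuadruple i then B else 0 :=
        Finset.sum_le_sum_of_subset_of_nonneg (Finset.subset_univ _) fun i _ _ => by
          split_ifs <;> simp [hB0]
    _ = (Finset.univ.filter fun i : Fin 4 → Fin (m + 1) → Fin N =>
          IsMatchedQuadruple i).card * B := by
        rw [← Finset.sum_filter, Finset.sum_const, nsmul_eq_mul]
    _ ≤ ((K * N ^ (2 * m + 2) : ℕ) : ℝ) * B :=
        mul_le_mul_of_nonneg_right (Nat.cast_le.2 (hK N hN)) hB0
    _ = K * B * (N : ℝ) ^ (2 * m + 2) := by push_cast; ring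

end FourthMoment

end ToeplitzEnsemble

theorem mainTheorem3 (p : Measure ℝ) [IsProbabilityMeasure p]
    (hmoments : ∀ k : ℕ, Integrable (fun x : ℝ => x ^ k) p)
    (hmean : ∫ x, x ∂p = 0) (hvar : ∫ x, x ^ 2 ∂p = 1) (m : ℕ) :
    ∃ C : ℝ, ∀ N : ℕ, 1 ≤ N →
      Integrable (ToeplitzEnsemble.spectralMoment m N) (ToeplitzEnsemble.ensemble p N) ∧
      Integrable (fun b => |ToeplitzEnsemble.spectralMoment m N b -
        ∫ b', ToeplitzEnsemble.spectralMoment m N b' ∂(ToeplitzEnsemble.ensemble p N)| ^ 4)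
        (ToeplitzEnsemble.ensemble p N) ∧
      ∫ b, |ToeplitzEnsemble.spectralMoment m N b -
        ∫ b', ToeplitzEnsemble.spectralMoment m N b' ∂(ToeplitzEnsemble.ensemble p N)| ^ 4
        ∂(ToeplitzEnsemble.ensemble p N) ≤ C / (N : ℝ) ^ 2 := by
  obtain ⟨C, hC⟩ :=
    ToeplitzEnsemble.exists_integral_trace_sub_integral_pow_four_le hmoments hmean m
  refine ⟨C, fun N hN => ?_⟩
  have hN0 : (0 : ℝ) < N := Nat.cast_pos.2 hN
  have habs : ∀ x : ℝ, |x| ^ 4 = x ^ 4 := fun x => (by decide : Even 4).pow_abs x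
  have hfun : ToeplitzEnsemble.spectralMoment m N = fun b =>
      ((N : ℝ) * √(N : ℝ) ^ m)⁻¹ * (ToeplitzEnsemble.toeplitz N b ^ m).trace :=
    funext fun b => ToeplitzEnsemble.spectralMoment_eq_trace m N b
  simp only [hfun, integral_const_mul, ← mul_sub, habs, mul_pow]
  refine ⟨(ToeplitzEnsemble.integrable_trace_toeplitz_pow hmoments m N).const_mul _,
    (ToeplitzEnsemble.integrable_trace_sub_integral_pow_four hmoments m N).const_mul _, ?_⟩
  -- The normalization exceeds the count of matched quadruples by exactly `N ^ 2`.
  have hw : (((N : ℝ) * √(N : ℝ) ^ m)⁻¹) ^ 4 = ((N : ℝ) ^ (2 * m + 2) * (N : ℝ) ^ 2)⁻¹ := by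
    have hs : (√(N : ℝ) ^ m) ^ 4 = (N : ℝ) ^ (2 * m) := by
      rw [← pow_mul, show m * 4 = 2 * (2 * m) by ring, pow_mul, Real.sq_sqrt hN0.le]
    rw [inv_pow, mul_pow, hs]
    congr 1
    ring
  rw [hw]
  calc ((N : ℝ) ^ (2 * m + 2) * (N : ℝ) ^ 2)⁻¹ * _
      ≤ ((N : ℝ) ^ (2 * m + 2) * (N : ℝ) ^ 2)⁻¹ * (C * (N : ℝ) ^ (2 * m + 2)) :=
        mul_le_mul_of_nonneg_left (hC N hN) (by positivity)
    _ = C / (N : ℝ) ^ 2 := by field_simp
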